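/- **Formulas.** Let $\mathcal V=\{p_1,p_2,\dots\}$ be a denumerable set of propositional variables and let $\Sigma_4=\{\land,\lor,\to,\neg\}$, $\Sigma_m=\{\to,\sim,\Box\}$ and $\Sigma=\Sigma_4\cup\Sigma_m$ ($\neg,\sim,\Box$ unary, the others binary). $For(\Theta)$ is the set of formulas over $\Theta$ generated by $\mathcal V$. All calculi below are Hilbert calculi given by axiom schemas, with modus ponens as the only rule, and $\Gamma\vdash_{\bf L}\varphi$ means that $\varphi$ is derivable from the (arbitrary) set $\Gamma$ in ${\bf L}$, using only formulas of the signature of ${\bf L}$. **$\mathcal{IDM}4$** over $\Sigma_4$, where $\varphi\leftrightarrow\psi$ abbreviates $(\varphi\to\psi)\land(\psi\to\varphi)$: (Ax1) $\varphi\to(\psi\to\varphi)$; (Ax2) $(\varphi\to(\psi\to\gamma))\to((\varphi\to\psi)\to(\varphi\to\gamma))$; (Ax3) $\varphi\to(\psi\to(\varphi\land\psi))$; (Ax4) $(\varphi\land\psi)\to\varphi$; (Ax5) $(\varphi\land\psi)\to\psi$; (Ax6) $\varphi\to(\varphi\lor\psi)$; (Ax7) $\psi\to(\varphi\lor\psi)$;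 (Ax8) $(\varphi\to\gamma)\to((\psi\to\gamma)\to((\varphi\lor\psi)\to\gamma))$; (DN) $\neg\neg\varphi\leftrightarrow\varphi$; (DM1) $\neg(\varphi\lor\psi)\leftrightarrow(\neg\varphi\land\neg\psi)$; (DM2) $\neg(\varphi\land\psi)\leftrightarrow(\neg\varphi\lor\neg\psi)$; (DM3) $\neg(\varphi\to\psi)\leftrightarrow(\varphi\land\neg\psi)$; (AxP) $\varphi\lor(\varphi\to\psi)$. **$Tm$** over $\Sigma_m$, where $\varphi\lor\psi$, $\varphi\land\psi$ and $\varphi\leftrightarrow\psi$ abbreviate $\sim\varphi\to\psi$, $\sim(\varphi\to\sim\psi)$ and $\sim((\varphi\to\psi)\to\sim(\psi\to\varphi))$: (Ax1); (Ax2); (Ax9) $(\sim\psi\to\sim\varphi)\to((\sim\psi\to\varphi)\to\psi)$; (K) $\Box(\varphi\to\psi)\to(\Box\varphi\to\Box\psi)$; (K1) $\Box(\varphi\to\psi)\to(\Box\sim\psi\to\Box\sim\varphi)$; (K2) $\Box\sim(\varphi\to\psi)\leftrightarrow(\Box\varphi\land\Box\sim\psi)$; (M1) $(\Box\sim\varphi\lor\Box\psi)\to\Box(\varphi\to\psi)$;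 (T) $\Box\varphi\to\varphi$; (DN1) $\Box\varphi\leftrightarrow\Box\sim\sim\varphi$. **$IvFDE_T$** over $\Sigma$: all schemas of $\mathcal{IDM}4$ and of $Tm$, instantiated with formulas over $\Sigma$, where now $\land,\lor$ are the primitive connectives of $\Sigma$ and $\varphi\leftrightarrow\psi$ abbreviates $(\varphi\to\psi)\land(\psi\to\varphi)$, together with: (N1) $\Box(\varphi\land\psi)\leftrightarrow(\Box\varphi\land\Box\psi)$; (N2) $\Box\sim(\varphi\lor\psi)\leftrightarrow\Box(\sim\varphi\land\sim\psi)$; (N3) $(\Box\sim\varphi\lor\Box\sim\psi)\to\Box\sim(\varphi\land\psi)$; (N4) $(\Box\varphi\lor\Box\psi)\to\Box(\varphi\lor\psi)$; (N5) $\Box\varphi\leftrightarrow\Box\sim\neg\varphi$; (N6) $\Box\sim\varphi\leftrightarrow\Box\sim\neg\neg\varphi$; (N7) $\Box\sim(\varphi\land\psi)\to(\Box\varphi\to\Box\sim\psi)$; (N8) $\Box\sim(\varphi\land\psi)\to(\Box\psi\to\Box\sim\varphi)$; (N9) $\Box(\varphi\lor\psi)\to(\Box\sim\varphi\to\Box\psi)$;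 (N10) $\Box(\varphi\lor\psi)\to(\Box\sim\psi\to\Box\varphi)$. **Extensions.** Consider the schemas (4) $\Box\varphi\to\Box\Box\varphi$; (5) $\sim\Box\sim\Box\varphi\to\Box\varphi$; (B) $\sim\Box\sim\Box\varphi\to\varphi$. The logics $T4m$, $T45m$, $TBm$, $T4Bm$, $T5m$ over $\Sigma_m$ are obtained from $Tm$ by adding, respectively, (4); (4) and (5); (B); (B) and (4); (5). The logics $IvFDE_{T4}$, $IvFDE_{T45}$, $IvFDE_{TB}$, $IvFDE_{T4B}$, $IvFDE_{T5}$ over $\Sigma$ are obtained in the same way from $IvFDE_T$, the schemas being instantiated with formulas over $\Sigma$. Let $\mathbb L=\{IvFDE_{T4}, IvFDE_{T45}, IvFDE_{TB}, IvFDE_{T4B}, IvFDE_{T5}\}$. **Theorem (Conservativity).** Each ${\bf L}\in\mathbb L$ conservatively expands $\mathcal{IDM}4$ and the Ivlev-like modal logic on which it is based. That is: (1) For every ${\bf L}\in\mathbb L$ and every $\Gamma\cup\{\varphi\}\subseteq For(\Sigma_4)$: $\Gamma\vdash_{\bf L}\varphi$ iff $\Gamma\vdash_{\mathcal{IDM}4}\varphi$.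 (2) For every $\Gamma\cup\{\varphi\}\subseteq For(\Sigma_m)$: (2.1) $\Gamma\vdash_{IvFDE_{T4}}\varphi$ iff $\Gamma\vdash_{T4m}\varphi$; (2.2) $\Gamma\vdash_{IvFDE_{T45}}\varphi$ iff $\Gamma\vdash_{T45m}\varphi$; (2.3) $\Gamma\vdash_{IvFDE_{TB}}\varphi$ iff $\Gamma\vdash_{TBm}\varphi$; (2.4) $\Gamma\vdash_{IvFDE_{T4B}}\varphi$ iff $\Gamma\vdash_{T4Bm}\varphi$; (2.5) $\Gamma\vdash_{IvFDE_{T5}}\varphi$ iff $\Gamma\vdash_{T5m}\varphi$. -/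

import Mathlib

namespace Paradef

/-- A Hilbert calculus on a set `F` of formulas with an implication: it is given by its set of
axioms (all instances of its axiom schemas); its only rule is modus ponens. -/
structure HilbertCalculus (F : Type) where
  imp : F → F → F
  axioms : Set F

namespace HilbertCalculus

/-- `H.Derives Γ φ`: there is a derivation of `φ` from `Γ` in `H`, i.e. `Γ ⊢ φ`. -/
inductive Derives {F : Type} (H : HilbertCalculus F) (Γ : Set F) : F → Prop
  | ax {φ : F} : φ ∈ H.axioms → Derives H Γ φ
  | hyp {φ : F} : φ ∈ Γ → Derives H Γ φ
  | mp {φ ψ : F} : Derives H Γ φ → Derives H Γ (H.imp φ ψ) → Derives H Γ ψ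

/-- The calculus obtained from `H` by adding the formulas in `S` as axioms. -/
def add {F : Type} (H : HilbertCalculus F) (S : Set F) : HilbertCalculus F where
  imp := H.imp
  axioms := H.axioms ∪ S

end HilbertCalculus

/-! ### Signatures

Formulas over the three signatures, with the propositional variables indexed by `ℕ`.
The constructor `neg` is the paradefinite negation `¬`, and `cneg` is the classical negation `∼`. -/

/-- `For(Σ₄)`, where `Σ₄ = {∧, ∨, →, ¬}`. -/
inductive Form4 : Type
  | var : ℕ → Form4
  | and : Form4 → Form4 → Form4
  | or : Form4 → Form4 → Form4
  | imp : Form4 → Form4 → Form4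
  | neg : Form4 → Form4

/-- `For(Σₘ)`, where `Σₘ = {→, ∼, □}`. -/
inductive FormM : Type
  | var : ℕ → FormM
  | imp : FormM → FormM → FormM
  | cneg : FormM → FormM
  | box : FormM → FormM

/-- `For(Σ)`, where `Σ = Σ₄ ∪ Σₘ = {∧, ∨, →, ¬, ∼, □}`. -/
inductive Form : Type
  | var : ℕ → Form
  | and : Form → Form → Form
  | or : Form → Form → Form
  | imp : Form → Form → Form
  | neg : Form → Form
  | cneg : Form → Form
  | box : Form → Form

/-- `φ ↔ ψ` over `Σ₄`, i.e. `(φ → ψ) ∧ (ψ → φ)`. -/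
def Form4.iff (φ ψ : Form4) : Form4 := .and (.imp φ ψ) (.imp ψ φ)

/-- `φ ∧ ψ` over `Σₘ`, i.e. `∼(φ → ∼ψ)`. -/
def FormM.and (φ ψ : FormM) : FormM := .cneg (.imp φ (.cneg ψ))

/-- `φ ∨ ψ` over `Σₘ`, i.e. `∼φ → ψ`. -/
def FormM.or (φ ψ : FormM) : FormM := .imp (.cneg φ) ψ

/-- `φ ↔ ψ` over `Σₘ`, i.e. `∼((φ → ψ) → ∼(ψ → φ))`. -/
def FormM.iff (φ ψ : FormM) : FormM := .and (.imp φ ψ) (.imp ψ φ)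

/-- `φ ↔ ψ` over `Σ`, i.e. `(φ → ψ) ∧ (ψ → φ)`. -/
def Form.iff (φ ψ : Form) : Form := .and (.imp φ ψ) (.imp ψ φ)

/-- The inclusion `For(Σ₄) ⊆ For(Σ)`. -/
def Form4.incl : Form4 → Form
  | .var n => .var n
  | .and φ ψ => .and φ.incl ψ.incl
  | .or φ ψ => .or φ.incl ψ.incl
  | .imp φ ψ => .imp φ.incl ψ.incl
  | .neg φ => .neg φ.incl

/-- The inclusion `For(Σₘ) ⊆ For(Σ)`. -/
def FormM.incl : FormM → Form
  | .var n => .var n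
  | .imp φ ψ => .imp φ.incl ψ.incl
  | .cneg φ => .cneg φ.incl
  | .box φ => .box φ.incl

/-! ### The logic `IDM4` over `Σ₄` -/

section
open Form4

/-- The axioms of `IDM4`. -/
inductive IDM4Ax : Form4 → Prop
  | ax1 (φ ψ) : IDM4Ax (imp φ (imp ψ φ))
  | ax2 (φ ψ γ) : IDM4Ax (imp (imp φ (imp ψ γ)) (imp (imp φ ψ) (imp φ γ)))
  | ax3 (φ ψ) : IDM4Ax (imp φ (imp ψ (and φ ψ)))
  | ax4 (φ ψ) : IDM4Ax (imp (and φ ψ) φ)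
  | ax5 (φ ψ) : IDM4Ax (imp (and φ ψ) ψ)
  | ax6 (φ ψ) : IDM4Ax (imp φ (or φ ψ))
  | ax7 (φ ψ) : IDM4Ax (imp ψ (or φ ψ))
  | ax8 (φ ψ γ) : IDM4Ax (imp (imp φ γ) (imp (imp ψ γ) (imp (or φ ψ) γ)))
  | dn (φ) : IDM4Ax (iff (neg (neg φ)) φ)
  | dm1 (φ ψ) : IDM4Ax (iff (neg (or φ ψ)) (and (neg φ) (neg ψ)))
  | dm2 (φ ψ) : IDM4Ax (iff (neg (and φ ψ)) (or (neg φ) (neg ψ)))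
  | dm3 (φ ψ) : IDM4Ax (iff (neg (imp φ ψ)) (and φ (neg ψ)))
  | axP (φ ψ) : IDM4Ax (or φ (imp φ ψ))

def IDM4 : HilbertCalculus Form4 := ⟨imp, {φ | IDM4Ax φ}⟩

end

/-! ### Ivlev's logic `Tm` and its axiomatic extensions over `Σₘ` -/

section
open FormM

/-- The axioms of `Tm`; here `and`, `or` and `iff` are the abbreviations over `Σₘ`. -/
inductive TmAx : FormM → Prop
  | ax1 (φ ψ) : TmAx (imp φ (imp ψ φ))
  | ax2 (φ ψ γ) : TmAx (imp (imp φ (imp ψ γ)) (imp (imp φ ψ) (imp φ γ)))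
  | ax9 (φ ψ) : TmAx (imp (imp (cneg ψ) (cneg φ)) (imp (imp (cneg ψ) φ) ψ))
  | k (φ ψ) : TmAx (imp (box (imp φ ψ)) (imp (box φ) (box ψ)))
  | k1 (φ ψ) : TmAx (imp (box (imp φ ψ)) (imp (box (cneg ψ)) (box (cneg φ))))
  | k2 (φ ψ) : TmAx (iff (box (cneg (imp φ ψ))) (and (box φ) (box (cneg ψ))))
  | m1 (φ ψ) : TmAx (imp (or (box (cneg φ)) (box ψ)) (box (imp φ ψ)))
  | t (φ) : TmAx (imp (box φ) φ)
  | dn1 (φ) : TmAx (iff (box φ) (box (cneg (cneg φ))))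

/-- Schema (4) over `Σₘ`. -/
def FormM.schema4 : Set FormM := {δ | ∃ φ, δ = imp (box φ) (box (box φ))}

/-- Schema (5) over `Σₘ`. -/
def FormM.schema5 : Set FormM := {δ | ∃ φ, δ = imp (cneg (box (cneg (box φ)))) (box φ)}

/-- Schema (B) over `Σₘ`. -/
def FormM.schemaB : Set FormM := {δ | ∃ φ, δ = imp (cneg (box (cneg (box φ)))) φ}

def Tm : HilbertCalculus FormM := ⟨imp, {φ | TmAx φ}⟩

def T4m : HilbertCalculus FormM := Tm.add FormM.schema4

def T45m : HilbertCalculus FormM := T4m.add FormM.schema5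

def TBm : HilbertCalculus FormM := Tm.add FormM.schemaB

def T4Bm : HilbertCalculus FormM := TBm.add FormM.schema4

def T5m : HilbertCalculus FormM := Tm.add FormM.schema5

end

/-! ### The combined logics over `Σ` -/

section
open Form

/-- The axioms of `IvFDE_T`: those of `IDM4`, those of `Tm` (with the primitive `∧` and `∨`, and
with `↔` abbreviated by means of the primitive `∧`), and the interaction axioms `n1`-`n10`. -/
inductive IvFDETAx : Form → Prop
  | ax1 (φ ψ) : IvFDETAx (imp φ (imp ψ φ))
  | ax2 (φ ψ γ) : IvFDETAx (imp (imp φ (imp ψ γ)) (imp (imp φ ψ) (imp φ γ)))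
  | ax3 (φ ψ) : IvFDETAx (imp φ (imp ψ (and φ ψ)))
  | ax4 (φ ψ) : IvFDETAx (imp (and φ ψ) φ)
  | ax5 (φ ψ) : IvFDETAx (imp (and φ ψ) ψ)
  | ax6 (φ ψ) : IvFDETAx (imp φ (or φ ψ))
  | ax7 (φ ψ) : IvFDETAx (imp ψ (or φ ψ))
  | ax8 (φ ψ γ) : IvFDETAx (imp (imp φ γ) (imp (imp ψ γ) (imp (or φ ψ) γ)))
  | dn (φ) : IvFDETAx (iff (neg (neg φ)) φ)
  | dm1 (φ ψ) : IvFDETAx (iff (neg (or φ ψ)) (and (neg φ) (neg ψ)))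
  | dm2 (φ ψ) : IvFDETAx (iff (neg (and φ ψ)) (or (neg φ) (neg ψ)))
  | dm3 (φ ψ) : IvFDETAx (iff (neg (imp φ ψ)) (and φ (neg ψ)))
  | axP (φ ψ) : IvFDETAx (or φ (imp φ ψ))
  | ax9 (φ ψ) : IvFDETAx (imp (imp (cneg ψ) (cneg φ)) (imp (imp (cneg ψ) φ) ψ))
  | k (φ ψ) : IvFDETAx (imp (box (imp φ ψ)) (imp (box φ) (box ψ)))
  | k1 (φ ψ) : IvFDETAx (imp (box (imp φ ψ)) (imp (box (cneg ψ)) (box (cneg φ))))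
  | k2 (φ ψ) : IvFDETAx (iff (box (cneg (imp φ ψ))) (and (box φ) (box (cneg ψ))))
  | m1 (φ ψ) : IvFDETAx (imp (or (box (cneg φ)) (box ψ)) (box (imp φ ψ)))
  | t (φ) : IvFDETAx (imp (box φ) φ)
  | dn1 (φ) : IvFDETAx (iff (box φ) (box (cneg (cneg φ))))
  | n1 (φ ψ) : IvFDETAx (iff (box (and φ ψ)) (and (box φ) (box ψ)))
  | n2 (φ ψ) : IvFDETAx (iff (box (cneg (or φ ψ))) (box (and (cneg φ) (cneg ψ))))
  | n3 (φ ψ) : IvFDETAx (imp (or (box (cneg φ)) (box (cneg ψ))) (box (cneg (and φ ψ))))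
  | n4 (φ ψ) : IvFDETAx (imp (or (box φ) (box ψ)) (box (or φ ψ)))
  | n5 (φ) : IvFDETAx (iff (box φ) (box (cneg (neg φ))))
  | n6 (φ) : IvFDETAx (iff (box (cneg φ)) (box (cneg (neg (neg φ)))))
  | n7 (φ ψ) : IvFDETAx (imp (box (cneg (and φ ψ))) (imp (box φ) (box (cneg ψ))))
  | n8 (φ ψ) : IvFDETAx (imp (box (cneg (and φ ψ))) (imp (box ψ) (box (cneg φ))))
  | n9 (φ ψ) : IvFDETAx (imp (box (or φ ψ)) (imp (box (cneg φ)) (box ψ)))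
  | n10 (φ ψ) : IvFDETAx (imp (box (or φ ψ)) (imp (box (cneg ψ)) (box φ)))

/-- Schema (4) over `Σ`. -/
def Form.schema4 : Set Form := {δ | ∃ φ, δ = imp (box φ) (box (box φ))}

/-- Schema (5) over `Σ`. -/
def Form.schema5 : Set Form := {δ | ∃ φ, δ = imp (cneg (box (cneg (box φ)))) (box φ)}

/-- Schema (B) over `Σ`. -/
def Form.schemaB : Set Form := {δ | ∃ φ, δ = imp (cneg (box (cneg (box φ)))) φ}

def IvFDE_T : HilbertCalculus Form := ⟨imp, {φ | IvFDETAx φ}⟩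

def IvFDE_T4 : HilbertCalculus Form := IvFDE_T.add Form.schema4

def IvFDE_T45 : HilbertCalculus Form := IvFDE_T4.add Form.schema5

def IvFDE_TB : HilbertCalculus Form := IvFDE_T.add Form.schemaB

def IvFDE_T4B : HilbertCalculus Form := IvFDE_TB.add Form.schema4

def IvFDE_T5 : HilbertCalculus Form := IvFDE_T.add Form.schema5

/-- The family `𝕃` of combined logics. -/
def combinedLogics : Set (HilbertCalculus Form) :=
  {IvFDE_T4, IvFDE_T45, IvFDE_TB, IvFDE_T4B, IvFDE_T5}

end

end Paradef

open Paradef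

/-!
Conservativity is proved semantically. A *model* of a Hilbert calculus is a two-valued assignment
on formulas that reads `→` as material implication and makes all axioms true. A Lindenbaum argument
shows that a calculus with classical implication is complete for its models
(`HilbertCalculus.IsClassical.exists_model`). Hence an expansion is conservative as soon as its
models restrict to models of the smaller calculus and every model of the smaller calculus is such a
restriction (`HilbertCalculus.derives_image_iff`). Restriction is a routine matter of checking
axioms; the content lies in extending models.

*Over `Σₘ`.* The translation `Form.toFormM`, which reads `¬` as `∼` and `∧`, `∨` as the usual
abbreviations, is the identity on `For(Σₘ)` and turns every axiom of `IvFDE_T` into a formula that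
holds in all models of `Tm`: the interaction axioms become instances of `K`, `K1`, `K2`, `M1` and
`DN1` up to propositional reasoning, and the modal schemas go to themselves. So a model
of a `Tm`-extension extends by composition with the translation (`IsModel.comp_toFormM`).

*Over `Σ₄`.* A model of `IDM4` is determined by the truth values of the variables and of their
negations, as in Belnap–Dunn logic (`Snapshot.eval_incl`). It is extended to `For(Σ)`
by a deterministic matrix whose values also record whether `□φ` and `□∼φ` hold. Letting
both fail for the variables, and letting every `□φ` be either necessary or impossible, makes all
the axioms true, the schemas (4), (5) and (B) included (`Snapshot.isModel_holds`). Thus one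
construction serves all five logics.
-/

namespace Paradef

namespace HilbertCalculus

variable {F G : Type}

/-! ### Models and completeness of Hilbert calculi -/

/-- A bivaluation that respects implication and makes every axiom true. The assignment making
all formulas true is not excluded. -/
structure IsModel (H : HilbertCalculus F) (v : F → Prop) : Prop where
  imp_iff : ∀ φ ψ, v (H.imp φ ψ) ↔ (v φ → v ψ)
  ax : ∀ φ ∈ H.axioms, v φ

/-- The calculus has the axioms for intuitionistic implication and allows reasoning by
cases on `φ` and `φ → ψ`, so that its implication is classical. -/
structure IsClassical (H : HilbertCalculus F) : Prop where
  ax1 : ∀ φ ψ, H.imp φ (H.imp ψ φ) ∈ H.axioms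
  ax2 : ∀ φ ψ γ, H.imp (H.imp φ (H.imp ψ γ)) (H.imp (H.imp φ ψ) (H.imp φ γ)) ∈ H.axioms
  cases : ∀ φ ψ γ, H.Derives {H.imp φ γ, H.imp (H.imp φ ψ) γ} γ

variable {H : HilbertCalculus F} {Γ Δ : Set F} {φ ψ : F}

theorem Derives.mono (hΓ : Γ ⊆ Δ) (h : H.Derives Γ φ) : H.Derives Δ φ := by
  induction h with
  | ax h => exact .ax h
  | hyp h => exact .hyp (hΓ h)
  | mp _ _ h₁ h₂ => exact .mp h₁ h₂

theorem Derives.add (S : Set F) (h : H.Derives Γ φ) : (H.add S).Derives Γ φ := by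
  induction h with
  | ax h => exact .ax (Or.inl h)
  | hyp h => exact .hyp h
  | mp _ _ h₁ h₂ => exact .mp h₁ h₂

theorem add_add (H : HilbertCalculus F) (S T : Set F) : (H.add S).add T = H.add (S ∪ T) := by
  simp [HilbertCalculus.add, Set.union_assoc]

theorem isModel_add {S : Set F} {v : F → Prop} :
    (H.add S).IsModel v ↔ H.IsModel v ∧ ∀ φ ∈ S, v φ :=
  ⟨fun h => ⟨⟨h.imp_iff, fun φ hφ => h.ax φ (Or.inl hφ)⟩, fun φ hφ => h.ax φ (Or.inr hφ)⟩,
    fun h => ⟨h.1.imp_iff, fun φ hφ => hφ.elim (h.1.ax φ) (h.2 φ)⟩⟩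

theorem IsModel.holds_of_derives {v : F → Prop} (hv : H.IsModel v) (hΓ : ∀ ψ ∈ Γ, v ψ)
    (h : H.Derives Γ φ) : v φ := by
  induction h with
  | ax h => exact hv.ax _ h
  | hyp h => exact hΓ _ h
  | mp _ _ h₁ h₂ => exact (hv.imp_iff _ _).1 h₂ h₁

/-- The deduction theorem. -/
theorem derives_imp_of_insert
    (ax1 : ∀ φ ψ, H.imp φ (H.imp ψ φ) ∈ H.axioms)
    (ax2 : ∀ φ ψ γ,
      H.imp (H.imp φ (H.imp ψ γ)) (H.imp (H.imp φ ψ) (H.imp φ γ)) ∈ H.axioms)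
    (h : H.Derives (insert ψ Γ) φ) : H.Derives Γ (H.imp ψ φ) := by
  induction h with
  | ax h => exact .mp (.ax h) (.ax (ax1 _ _))
  | hyp h =>
    rcases h with h | h
    · rw [h]
      exact .mp (.ax (ax1 _ ψ)) (.mp (.ax (ax1 _ (H.imp _ _))) (.ax (ax2 _ _ _)))
    · exact .mp (.hyp h) (.ax (ax1 _ _))
  | mp _ _ h₁ h₂ => exact .mp h₁ (.mp h₂ (.ax (ax2 _ _ _)))

theorem exists_derives_of_derives_sUnion {c : Set (Set F)} (hc : IsChain (· ⊆ ·) c)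
    (hne : c.Nonempty) (h : H.Derives (⋃₀ c) φ) : ∃ s ∈ c, H.Derives s φ := by
  induction h with
  | ax h => exact ⟨hne.some, hne.some_mem, .ax h⟩
  | hyp h =>
    obtain ⟨s, hs, h⟩ := h
    exact ⟨s, hs, .hyp h⟩
  | mp _ _ h₁ h₂ =>
    obtain ⟨s, hs, h₁⟩ := h₁
    obtain ⟨t, ht, h₂⟩ := h₂
    rcases hc.total hs ht with hst | hts
    · exact ⟨t, ht, .mp (h₁.mono hst) h₂⟩
    · exact ⟨s, hs, .mp h₁ (h₂.mono hts)⟩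

namespace IsClassical

theorem add (hH : H.IsClassical) (S : Set F) : (H.add S).IsClassical where
  ax1 φ ψ := Or.inl (hH.ax1 φ ψ)
  ax2 φ ψ γ := Or.inl (hH.ax2 φ ψ γ)
  cases φ ψ γ := (hH.cases φ ψ γ).add S

/-- Completeness: membership in a set that is maximal among those not deriving `φ` is a model. -/
theorem exists_model (hH : H.IsClassical) (h : ¬ H.Derives Γ φ) :
    ∃ v, H.IsModel v ∧ (∀ ψ ∈ Γ, v ψ) ∧ ¬ v φ := by
  obtain ⟨Δ, hΓΔ, hΔ⟩ := zorn_subset_nonempty {Δ | ¬ H.Derives Δ φ}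
    (fun c hcS hc hne => ⟨⋃₀ c, fun hd =>
      have ⟨s, hs, hsd⟩ := exists_derives_of_derives_sUnion hc hne hd
      hcS hs hsd, fun s hs => Set.subset_sUnion_of_mem hs⟩) Γ h
  have imp_mem : ∀ ψ, ψ ∉ Δ → H.Derives Δ (H.imp ψ φ) := fun ψ hψ =>
    derives_imp_of_insert hH.ax1 hH.ax2 <| by
      by_contra hd
      exact hψ (hΔ.2 hd (Set.subset_insert ψ Δ) (Set.mem_insert ψ Δ))
  have closed : ∀ ψ, H.Derives Δ ψ → ψ ∈ Δ := fun ψ hd => by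
    by_contra hψ
    exact hΔ.1 (.mp hd (imp_mem ψ hψ))
  refine ⟨(· ∈ Δ), ⟨fun ψ χ => ⟨fun hi hψ => closed _ (.mp (.hyp hψ) (.hyp hi)), fun hi => ?_⟩,
    fun ψ hψ => closed _ (.ax hψ)⟩, fun ψ hψ => hΓΔ hψ, fun hφ => hΔ.1 (.hyp hφ)⟩
  by_cases hψ : ψ ∈ Δ
  · exact closed _ (.mp (.hyp (hi hψ)) (.ax (hH.ax1 _ _)))
  · by_contra hi'
    refine hΔ.1 ((hH.cases ψ χ φ).mono ?_)
    rintro _ (rfl | rfl)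
    exacts [closed _ (imp_mem _ hψ), closed _ (imp_mem _ hi')]

end IsClassical

/-- A conservativity criterion: along `e`, the nontrivial models of `K` restrict to models of `H`,
and every nontrivial model of `H` arises in this way. -/
theorem derives_image_iff {K : HilbertCalculus G} (hH : H.IsClassical) (hK : K.IsClassical)
    (e : F → G)
    (restrict : ∀ w, K.IsModel w → (∃ ψ, ¬ w ψ) → H.IsModel fun ψ => w (e ψ))
    (extend : ∀ v, H.IsModel v → (∃ ψ, ¬ v ψ) → ∃ w, K.IsModel w ∧ ∀ ψ, w (e ψ) ↔ v ψ) :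
    K.Derives (e '' Γ) (e φ) ↔ H.Derives Γ φ := by
  constructor <;> intro h <;> by_contra hn
  · obtain ⟨v, hv, hvΓ, hvφ⟩ := hH.exists_model hn
    obtain ⟨w, hw, hwv⟩ := extend v hv ⟨φ, hvφ⟩
    refine hvφ ((hwv φ).1 (hw.holds_of_derives ?_ h))
    rintro _ ⟨ψ, hψ, rfl⟩
    exact (hwv ψ).2 (hvΓ ψ hψ)
  · obtain ⟨w, hw, hwΓ, hwφ⟩ := hK.exists_model hn
    exact hwφ ((restrict w hw ⟨_, hwφ⟩).holds_of_derives
      (fun ψ hψ => hwΓ _ (Set.mem_image_of_mem e hψ)) h)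

end HilbertCalculus

open HilbertCalculus

/-! ### The three base calculi have classical implication -/

theorem isClassical_IDM4 : IDM4.IsClassical where
  ax1 := .ax1
  ax2 := .ax2
  cases φ ψ γ := .mp (.ax (.axP φ ψ)) (.mp (.hyp (Or.inr rfl))
    (.mp (.hyp (Or.inl rfl)) (.ax (.ax8 φ (.imp φ ψ) γ))))

theorem isClassical_IvFDE_T : IvFDE_T.IsClassical where
  ax1 := .ax1
  ax2 := .ax2
  cases φ ψ γ := .mp (.ax (.axP φ ψ)) (.mp (.hyp (Or.inr rfl))
    (.mp (.hyp (Or.inl rfl)) (.ax (.ax8 φ (.imp φ ψ) γ))))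

section
variable {Γ : Set FormM} {φ ψ : FormM}

theorem Tm_derives_imp (h : Tm.Derives (insert ψ Γ) φ) : Tm.Derives Γ (.imp ψ φ) :=
  derives_imp_of_insert TmAx.ax1 TmAx.ax2 h

/-- Proof by contradiction, from (Ax9). -/
theorem Tm_derives_of_cneg (h₁ : Tm.Derives (insert (.cneg φ) Γ) ψ)
    (h₂ : Tm.Derives (insert (.cneg φ) Γ) (.cneg ψ)) : Tm.Derives Γ φ :=
  .mp (Tm_derives_imp h₁) (.mp (Tm_derives_imp h₂) (.ax (.ax9 ψ φ)))

end

/-- Reasoning by cases on `φ` and `φ → ψ` is obtained from (Ax9): if `γ` is refuted then so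
is `φ`, whence `φ → ψ` and therefore `γ`. -/
theorem isClassical_Tm : Tm.IsClassical where
  ax1 := .ax1
  ax2 := .ax2
  cases φ ψ γ := by
    refine Tm_derives_of_cneg (ψ := γ) ?_ (.hyp (by simp))
    refine .mp (φ := .imp φ ψ) (Tm_derives_imp ?_) (.hyp (by simp [Tm]))
    refine Tm_derives_of_cneg (ψ := γ) ?_ (.hyp (by simp))
    exact .mp (φ := φ) (.hyp (by simp)) (.hyp (by simp [Tm]))

/-! ### Connectives in models -/

namespace HilbertCalculus.IsModel

theorem imp_IDM4 {v : Form4 → Prop} (hv : IDM4.IsModel v) (φ ψ : Form4) :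
    v (.imp φ ψ) ↔ (v φ → v ψ) :=
  hv.imp_iff φ ψ

theorem and_IDM4 {v : Form4 → Prop} (hv : IDM4.IsModel v) (φ ψ : Form4) :
    v (.and φ ψ) ↔ v φ ∧ v ψ := by
  have h₃ := hv.ax _ (.ax3 φ ψ)
  have h₄ := hv.ax _ (.ax4 φ ψ)
  have h₅ := hv.ax _ (.ax5 φ ψ)
  simp only [hv.imp_IDM4] at h₃ h₄ h₅
  tauto

theorem or_IDM4 {v : Form4 → Prop} (hv : IDM4.IsModel v) (φ ψ : Form4) :
    v (.or φ ψ) ↔ v φ ∨ v ψ := by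
  have h₆ := hv.ax _ (.ax6 φ ψ)
  have h₇ := hv.ax _ (.ax7 φ ψ)
  -- (Ax8) with the disjunction's first or second member as conclusion
  have h₈ := hv.ax _ (.ax8 φ ψ φ)
  have h₈' := hv.ax _ (.ax8 φ ψ ψ)
  simp only [hv.imp_IDM4] at h₆ h₇ h₈ h₈'
  tauto

theorem iff_IDM4 {v : Form4 → Prop} (hv : IDM4.IsModel v) (φ ψ : Form4) :
    v (.iff φ ψ) ↔ (v φ ↔ v ψ) := by
  rw [Form4.iff, hv.and_IDM4, hv.imp_IDM4, hv.imp_IDM4, ← iff_iff_implies_and_implies]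

theorem imp_IvFDE {w : Form → Prop} (hw : IvFDE_T.IsModel w) (φ ψ : Form) :
    w (.imp φ ψ) ↔ (w φ → w ψ) :=
  hw.imp_iff φ ψ

theorem and_IvFDE {w : Form → Prop} (hw : IvFDE_T.IsModel w) (φ ψ : Form) :
    w (.and φ ψ) ↔ w φ ∧ w ψ := by
  have h₃ := hw.ax _ (.ax3 φ ψ)
  have h₄ := hw.ax _ (.ax4 φ ψ)
  have h₅ := hw.ax _ (.ax5 φ ψ)
  simp only [hw.imp_IvFDE] at h₃ h₄ h₅
  tauto

theorem or_IvFDE {w : Form → Prop} (hw : IvFDE_T.IsModel w) (φ ψ : Form) :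
    w (.or φ ψ) ↔ w φ ∨ w ψ := by
  have h₆ := hw.ax _ (.ax6 φ ψ)
  have h₇ := hw.ax _ (.ax7 φ ψ)
  have h₈ := hw.ax _ (.ax8 φ ψ φ)
  have h₈' := hw.ax _ (.ax8 φ ψ ψ)
  simp only [hw.imp_IvFDE] at h₆ h₇ h₈ h₈'
  tauto

theorem iff_IvFDE {w : Form → Prop} (hw : IvFDE_T.IsModel w) (φ ψ : Form) :
    w (.iff φ ψ) ↔ (w φ ↔ w ψ) := by
  rw [Form.iff, hw.and_IvFDE, hw.imp_IvFDE, hw.imp_IvFDE, ← iff_iff_implies_and_implies]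

/-- By (Ax9), a formula true together with its classical negation makes every formula true. -/
theorem cneg_IvFDE {w : Form → Prop} (hw : IvFDE_T.IsModel w) (hne : ∃ ψ, ¬ w ψ) (φ : Form) :
    w (.cneg φ) ↔ ¬ w φ := by
  obtain ⟨ψ, hψ⟩ := hne
  have h₁ := hw.ax _ (.ax9 φ ψ)
  have h₂ := hw.ax _ (.ax9 φ φ)
  simp only [hw.imp_IvFDE] at h₁ h₂
  tauto

theorem imp_Tm {v : FormM → Prop} (hv : Tm.IsModel v) (φ ψ : FormM) :
    v (.imp φ ψ) ↔ (v φ → v ψ) :=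
  hv.imp_iff φ ψ

theorem cneg_Tm {v : FormM → Prop} (hv : Tm.IsModel v) (hne : ∃ ψ, ¬ v ψ) (φ : FormM) :
    v (.cneg φ) ↔ ¬ v φ := by
  obtain ⟨ψ, hψ⟩ := hne
  have h₁ := hv.ax _ (.ax9 φ ψ)
  have h₂ := hv.ax _ (.ax9 φ φ)
  simp only [hv.imp_Tm] at h₁ h₂
  tauto

end HilbertCalculus.IsModel

/-- A bivaluation of `Σₘ`-formulas that is classical on `→` and `∼`. -/
structure IsBoolean (v : FormM → Prop) : Prop where
  imp : ∀ φ ψ, v (.imp φ ψ) ↔ (v φ → v ψ)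
  cneg : ∀ φ, v (.cneg φ) ↔ ¬ v φ

namespace IsBoolean

variable {v : FormM → Prop}

theorem and (hv : IsBoolean v) (φ ψ : FormM) : v (.and φ ψ) ↔ v φ ∧ v ψ := by
  simp only [FormM.and, hv.imp, hv.cneg]; tauto

theorem or (hv : IsBoolean v) (φ ψ : FormM) : v (.or φ ψ) ↔ v φ ∨ v ψ := by
  simp only [FormM.or, hv.imp, hv.cneg]; tauto

theorem iff (hv : IsBoolean v) (φ ψ : FormM) : v (.iff φ ψ) ↔ (v φ ↔ v ψ) := by
  rw [FormM.iff, hv.and, hv.imp, hv.imp, ← iff_iff_implies_and_implies]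

end IsBoolean

theorem HilbertCalculus.IsModel.isBoolean {v : FormM → Prop} (hv : Tm.IsModel v)
    (hne : ∃ ψ, ¬ v ψ) : IsBoolean v :=
  ⟨hv.imp_Tm, hv.cneg_Tm hne⟩

/-! ### Conservativity over the Ivlev-like logics -/

/-- The translation of `For(Σ)` into `For(Σₘ)` that identifies both negations and reads `∧` and
`∨` as abbreviations. -/
def Form.toFormM : Form → FormM
  | .var n => .var n
  | .and φ ψ => .and φ.toFormM ψ.toFormM
  | .or φ ψ => .or φ.toFormM ψ.toFormM
  | .imp φ ψ => .imp φ.toFormM ψ.toFormM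
  | .neg φ => .cneg φ.toFormM
  | .cneg φ => .cneg φ.toFormM
  | .box φ => .box φ.toFormM

theorem FormM.toFormM_incl (φ : FormM) : φ.incl.toFormM = φ := by
  induction φ <;> simp_all [FormM.incl, Form.toFormM]

namespace HilbertCalculus.IsModel

theorem comp_toFormM {v : FormM → Prop} (hv : Tm.IsModel v) (hne : ∃ ψ, ¬ v ψ) :
    IvFDE_T.IsModel fun φ => v φ.toFormM := by
  have hb := hv.isBoolean hne
  have hk φ ψ := hv.ax _ (.k φ ψ)
  have hk1 φ ψ := hv.ax _ (.k1 φ ψ)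
  have hk2 φ ψ := hv.ax _ (.k2 φ ψ)
  have hm1 φ ψ := hv.ax _ (.m1 φ ψ)
  have ht φ := hv.ax _ (.t φ)
  have hdn φ := hv.ax _ (.dn1 φ)
  simp only [hb.imp, hb.and, hb.or, hb.iff] at hk hk1 hk2 hm1 ht hdn
  refine ⟨fun φ ψ => hb.imp _ _, fun φ hφ => ?_⟩
  cases hφ with
  | k => simpa only [Form.toFormM, hb.imp] using hk _ _
  | k1 => simpa only [Form.toFormM, hb.imp] using hk1 _ _
  | t => simpa only [Form.toFormM, hb.imp] using ht _
  | n2 | n3 | n4 | n7 | n8 | n9 | n10 =>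
    simp only [Form.toFormM, Form.iff, hb.imp, hb.and, hb.or]
    simp only [FormM.and, FormM.or]
    grind
  | _ =>
    simp only [Form.toFormM, Form.iff, hb.imp, hb.cneg, hb.and, hb.or]
    try simp only [FormM.and]
    grind

theorem comp_inclM {w : Form → Prop} (hw : IvFDE_T.IsModel w) (hne : ∃ ψ, ¬ w ψ) :
    Tm.IsModel fun φ => w φ.incl := by
  have hb : IsBoolean fun φ => w φ.incl :=
    ⟨fun φ ψ => hw.imp_IvFDE _ _, fun φ => hw.cneg_IvFDE hne _⟩
  refine ⟨hb.imp, fun φ hφ => ?_⟩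
  cases hφ with
  | ax1 φ ψ => exact hw.ax _ (.ax1 _ _)
  | ax2 φ ψ γ => exact hw.ax _ (.ax2 _ _ _)
  | ax9 φ ψ => exact hw.ax _ (.ax9 _ _)
  | k φ ψ => exact hw.ax _ (.k _ _)
  | k1 φ ψ => exact hw.ax _ (.k1 _ _)
  | t φ => exact hw.ax _ (.t _)
  | k2 φ ψ =>
    have h := hw.ax _ (.k2 φ.incl ψ.incl)
    rw [hw.iff_IvFDE, hw.and_IvFDE] at h
    exact (hb.iff _ _).2 (h.trans (hb.and (.box φ) (.box (.cneg ψ))).symm)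
  | m1 φ ψ =>
    have h := hw.ax _ (.m1 φ.incl ψ.incl)
    rw [hw.imp_IvFDE, hw.or_IvFDE] at h
    exact (hb.imp _ _).2 fun h' => h ((hb.or _ _).1 h')
  | dn1 φ =>
    have h := hw.ax _ (.dn1 φ.incl)
    rw [hw.iff_IvFDE] at h
    exact (hb.iff _ _).2 h

end HilbertCalculus.IsModel

/-- The set `S` of additional axioms over `Σ` and the set `T` over `Σₘ` contain each other's
translations. -/
structure Correspond (S : Set Form) (T : Set FormM) : Prop where
  toFormM_mem : ∀ δ ∈ S, δ.toFormM ∈ T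
  incl_mem : ∀ δ ∈ T, δ.incl ∈ S

theorem Correspond.union {S S' : Set Form} {T T' : Set FormM} (h : Correspond S T)
    (h' : Correspond S' T') : Correspond (S ∪ S') (T ∪ T') :=
  ⟨fun δ => Or.imp (h.toFormM_mem δ) (h'.toFormM_mem δ),
    fun δ => Or.imp (h.incl_mem δ) (h'.incl_mem δ)⟩

theorem correspond_schema4 : Correspond Form.schema4 FormM.schema4 where
  toFormM_mem := by rintro _ ⟨φ, rfl⟩; exact ⟨φ.toFormM, rfl⟩
  incl_mem := by rintro _ ⟨φ, rfl⟩; exact ⟨φ.incl, rfl⟩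

theorem correspond_schema5 : Correspond Form.schema5 FormM.schema5 where
  toFormM_mem := by rintro _ ⟨φ, rfl⟩; exact ⟨φ.toFormM, rfl⟩
  incl_mem := by rintro _ ⟨φ, rfl⟩; exact ⟨φ.incl, rfl⟩

theorem correspond_schemaB : Correspond Form.schemaB FormM.schemaB where
  toFormM_mem := by rintro _ ⟨φ, rfl⟩; exact ⟨φ.toFormM, rfl⟩
  incl_mem := by rintro _ ⟨φ, rfl⟩; exact ⟨φ.incl, rfl⟩

theorem Correspond.derives_incl_iff {S : Set Form} {T : Set FormM} (h : Correspond S T)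
    (Γ : Set FormM) (φ : FormM) :
    (IvFDE_T.add S).Derives (FormM.incl '' Γ) φ.incl ↔ (Tm.add T).Derives Γ φ := by
  refine derives_image_iff (isClassical_Tm.add T) (isClassical_IvFDE_T.add S) FormM.incl ?_ ?_
  · intro w hw hne
    rw [isModel_add] at hw ⊢
    exact ⟨hw.1.comp_inclM hne, fun δ hδ => hw.2 _ (h.incl_mem δ hδ)⟩
  · intro v hv hne
    rw [isModel_add] at hv
    refine ⟨fun φ => v φ.toFormM, isModel_add.2 ⟨hv.1.comp_toFormM hne,
      fun δ hδ => hv.2 _ (h.toFormM_mem δ hδ)⟩, fun ψ => ?_⟩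
    simp only [ψ.toFormM_incl]

/-! ### Conservativity over `IDM4` -/

/-- A truth value for `Σ`-formulas. Its components say whether `φ`, `¬φ`, `□φ` and `□∼φ` hold. -/
structure Snapshot where
  pos : Prop
  neg : Prop
  nec : Prop
  imposs : Prop

namespace Snapshot

/-- The value of a formula, given the Belnap–Dunn values `(p n, q n)` of the variables. The first
two components follow `IDM4`. Variables are neither necessary nor impossible, and boxed formulas
are always one or the other. The `neg` component of `∼φ`, on which `IDM4` is silent, is chosen so that
`∼` carries necessary values to impossible ones and back (see `eval_coherent`). -/
def eval (p q : ℕ → Prop) : Form → Snapshot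
  | .var n => ⟨p n, q n, False, False⟩
  | .and φ ψ =>
    let x := eval p q φ
    let y := eval p q ψ
    ⟨x.pos ∧ y.pos, x.neg ∨ y.neg, x.nec ∧ y.nec, x.imposs ∨ y.imposs⟩
  | .or φ ψ =>
    let x := eval p q φ
    let y := eval p q ψ
    ⟨x.pos ∨ y.pos, x.neg ∧ y.neg, x.nec ∨ y.nec, x.imposs ∧ y.imposs⟩
  | .imp φ ψ =>
    let x := eval p q φ
    let y := eval p q ψ
    ⟨x.pos → y.pos, x.pos ∧ y.neg, x.imposs ∨ y.nec, x.nec ∧ y.imposs⟩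
  | .neg φ =>
    let x := eval p q φ
    ⟨x.neg, x.pos, x.imposs, x.nec⟩
  | .cneg φ =>
    let x := eval p q φ
    ⟨¬ x.pos, ¬ x.neg, x.imposs, x.nec⟩
  | .box φ =>
    let x := eval p q φ
    ⟨x.nec, ¬ x.nec, x.nec, ¬ x.nec⟩

variable (p q : ℕ → Prop)

/-- Necessary formulas are true with a false negation, and impossible ones are the reverse. -/
theorem eval_coherent (φ : Form) :
    ((eval p q φ).nec → (eval p q φ).pos ∧ ¬ (eval p q φ).neg) ∧
    ((eval p q φ).imposs → ¬ (eval p q φ).pos ∧ (eval p q φ).neg) := by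
  induction φ <;> simp only [eval] <;> tauto

theorem isModel_holds :
    (IvFDE_T.add (Form.schema4 ∪ Form.schema5 ∪ Form.schemaB)).IsModel
      fun φ => (eval p q φ).pos := by
  have hc := eval_coherent p q
  refine isModel_add.2 ⟨⟨fun φ ψ => Iff.rfl, fun φ hφ => ?_⟩, ?_⟩
  · cases hφ with
    | ax1 φ ψ | ax3 φ ψ | ax4 φ ψ | ax5 φ ψ | ax6 φ ψ | ax7 φ ψ | dm1 φ ψ | dm2 φ ψ | dm3 φ ψ
    | axP φ ψ | ax9 φ ψ | k φ ψ | k1 φ ψ | k2 φ ψ | m1 φ ψ | n1 φ ψ | n2 φ ψ | n3 φ ψ | n4 φ ψ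
    | n7 φ ψ | n8 φ ψ | n9 φ ψ | n10 φ ψ =>
      have hφ := hc φ
      have hψ := hc ψ
      simp only [eval, Form.iff]
      tauto
    | ax2 φ ψ γ | ax8 φ ψ γ =>
      simp only [eval]
      tauto
    | dn φ | t φ | dn1 φ | n5 φ | n6 φ =>
      have hφ := hc φ
      simp only [eval, Form.iff]
      tauto
  · rintro _ ((⟨φ, rfl⟩ | ⟨φ, rfl⟩) | ⟨φ, rfl⟩) <;>
    · have hφ := hc φ
      simp only [eval]
      tauto

variable {v : Form4 → Prop}

/-- A model of `IDM4` is determined on `ψ` and `¬ψ` by its values on variables and their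
negations. -/
theorem eval_incl (hv : IDM4.IsModel v) (ψ : Form4) :
    ((eval (fun n => v (.var n)) (fun n => v (.neg (.var n))) ψ.incl).pos ↔ v ψ) ∧
    ((eval (fun n => v (.var n)) (fun n => v (.neg (.var n))) ψ.incl).neg ↔ v (.neg ψ)) := by
  have hdn φ := hv.ax _ (.dn φ)
  have hdm1 φ ψ := hv.ax _ (.dm1 φ ψ)
  have hdm2 φ ψ := hv.ax _ (.dm2 φ ψ)
  have hdm3 φ ψ := hv.ax _ (.dm3 φ ψ)
  simp only [hv.iff_IDM4, hv.and_IDM4, hv.or_IDM4] at hdn hdm1 hdm2 hdm3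
  induction ψ with
  | var n => exact ⟨Iff.rfl, Iff.rfl⟩
  | and φ ψ ihφ ihψ => simp only [Form4.incl, eval, ihφ, ihψ, hv.and_IDM4, hdm2, and_self]
  | or φ ψ ihφ ihψ => simp only [Form4.incl, eval, ihφ, ihψ, hv.or_IDM4, hdm1, and_self]
  | imp φ ψ ihφ ihψ => simp only [Form4.incl, eval, ihφ, ihψ, hv.imp_IDM4, hdm3, and_self]
  | neg φ ih => simp only [Form4.incl, eval, ih, hdn, and_self]

end Snapshot

theorem HilbertCalculus.IsModel.comp_incl4 {w : Form → Prop} (hw : IvFDE_T.IsModel w) :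
    IDM4.IsModel fun φ => w φ.incl := by
  refine ⟨fun φ ψ => hw.imp_IvFDE _ _, fun φ hφ => ?_⟩
  cases hφ with
  | ax1 => exact hw.ax _ (.ax1 _ _)
  | ax2 => exact hw.ax _ (.ax2 _ _ _)
  | ax3 => exact hw.ax _ (.ax3 _ _)
  | ax4 => exact hw.ax _ (.ax4 _ _)
  | ax5 => exact hw.ax _ (.ax5 _ _)
  | ax6 => exact hw.ax _ (.ax6 _ _)
  | ax7 => exact hw.ax _ (.ax7 _ _)
  | ax8 => exact hw.ax _ (.ax8 _ _ _)
  | dn => exact hw.ax _ (.dn _)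
  | dm1 => exact hw.ax _ (.dm1 _ _)
  | dm2 => exact hw.ax _ (.dm2 _ _)
  | dm3 => exact hw.ax _ (.dm3 _ _)
  | axP => exact hw.ax _ (.axP _ _)

theorem derives_incl4_iff {S : Set Form} (hS : S ⊆ Form.schema4 ∪ Form.schema5 ∪ Form.schemaB)
    (Γ : Set Form4) (φ : Form4) :
    (IvFDE_T.add S).Derives (Form4.incl '' Γ) φ.incl ↔ IDM4.Derives Γ φ := by
  refine derives_image_iff isClassical_IDM4 (isClassical_IvFDE_T.add S) Form4.incl
    (fun w hw _ => (isModel_add.1 hw).1.comp_incl4) fun v hv _ => ?_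
  have h := isModel_add.1
    (Snapshot.isModel_holds (fun n => v (.var n)) (fun n => v (.neg (.var n))))
  exact ⟨_, isModel_add.2 ⟨h.1, fun δ hδ => h.2 δ (hS hδ)⟩,
    fun ψ => (Snapshot.eval_incl hv ψ).1⟩

end Paradef

open Paradef
theorem mainTheorem7 :
    (∀ L ∈ combinedLogics, ∀ (Γ : Set Form4) (φ : Form4),
      L.Derives (Form4.incl '' Γ) φ.incl ↔ IDM4.Derives Γ φ) ∧
    (∀ (Γ : Set FormM) (φ : FormM),
      (IvFDE_T4.Derives (FormM.incl '' Γ) φ.incl ↔ T4m.Derives Γ φ) ∧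
      (IvFDE_T45.Derives (FormM.incl '' Γ) φ.incl ↔ T45m.Derives Γ φ) ∧
      (IvFDE_TB.Derives (FormM.incl '' Γ) φ.incl ↔ TBm.Derives Γ φ) ∧
      (IvFDE_T4B.Derives (FormM.incl '' Γ) φ.incl ↔ T4Bm.Derives Γ φ) ∧
      (IvFDE_T5.Derives (FormM.incl '' Γ) φ.incl ↔ T5m.Derives Γ φ)) := by
  have e45 : IvFDE_T45 = IvFDE_T.add (Form.schema4 ∪ Form.schema5) := HilbertCalculus.add_add ..
  have e4B : IvFDE_T4B = IvFDE_T.add (Form.schemaB ∪ Form.schema4) := HilbertCalculus.add_add ..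
  have m45 : T45m = Tm.add (FormM.schema4 ∪ FormM.schema5) := HilbertCalculus.add_add ..
  have m4B : T4Bm = Tm.add (FormM.schemaB ∪ FormM.schema4) := HilbertCalculus.add_add ..
  refine ⟨?_, fun Γ φ => ⟨correspond_schema4.derives_incl_iff Γ φ, ?_,
    correspond_schemaB.derives_incl_iff Γ φ, ?_, correspond_schema5.derives_incl_iff Γ φ⟩⟩
  · rintro L (rfl | rfl | rfl | rfl | rfl) Γ φ
    · exact derives_incl4_iff (fun δ hδ => Or.inl (Or.inl hδ)) Γ φ
    · rw [e45]
      exact derives_incl4_iff Set.subset_union_left Γ φ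
    · exact derives_incl4_iff Set.subset_union_right Γ φ
    · rw [e4B]
      exact derives_incl4_iff (fun δ hδ => hδ.elim Or.inr fun h => Or.inl (Or.inl h)) Γ φ
    · exact derives_incl4_iff (fun δ hδ => Or.inl (Or.inr hδ)) Γ φ
  · rw [e45, m45]
    exact (correspond_schema4.union correspond_schema5).derives_incl_iff Γ φ
  · rw [e4B, m4B]
    exact (correspond_schemaB.union correspond_schema4).derives_incl_iff Γ φ
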